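/- Let $n\ge 1$. A convex body in $\mathbb{R}^n$ is a compact convex set with nonempty interior, and $|\cdot|$ denotes $n$-dimensional volume (and the Euclidean norm for vectors). A convex body $K\subset\mathbb{R}^n$ is said to be in isotropic position if, among all affine volume preserving maps $T:\mathbb{R}^n\to\mathbb{R}^n$, the quantity $\frac{1}{|K|}\int_K \frac{|Tx|^2}{n}\,dx$ is minimized by the identity map. The isotropic constant $L_K>0$ of a convex body $K$ is the number such that, for some affine volume preserving map $u$ with $K'=u(K)$ in isotropic position, $$L_K^2 = |K'|^{-2/n}\,\frac{1}{|K'|}\int_{K'}\langle x,\theta\rangle^2\,dx\qquad\text{for every unit vector }\theta .$$ Let $A,B$ be convex bodies in $\mathbb{R}^n$. Then $A$ and $B$ can be put in isotropic position by affine volume preserving maps, with isotropic constants $L_A,L_B>0$ as above, and for all affine volume preserving maps $u_1,u_2$ such that $\widetilde A=u_1(A)$ and $\widetilde B=u_2(B)$ are in isotropic position, $$\frac{1}{8\pi e}\,\big|\widetilde A+\widetilde B\big|^{2/n}\le L_A^2\,|A|^{2/n}+L_B^2\,|B|^{2/n}.$$ -/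

import Mathlib

open MeasureTheory
open scoped Pointwise

/-- An affine bijection of `ℝⁿ` that preserves `n`-dimensional volume. -/
def IsVolumePreservingAffine {n : ℕ}
    (T : EuclideanSpace ℝ (Fin n) ≃ᵃ[ℝ] EuclideanSpace ℝ (Fin n)) : Prop :=
  MeasurePreserving T volume volume

/-- The normalized second moment `∫ |Tx|² / n f(x) dx` of the affine image under `T` of the
uniform distribution on `K`, where `f = 1_K / |K|`. -/
noncomputable def normalizedSecondMoment {n : ℕ} (K : Set (EuclideanSpace ℝ (Fin n)))
    (T : EuclideanSpace ℝ (Fin n) ≃ᵃ[ℝ] EuclideanSpace ℝ (Fin n)) : ℝ :=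
  (volume.real K)⁻¹ * ∫ x in K, ‖T x‖ ^ 2 / (n : ℝ)

/-- `K` is in isotropic position: among all affine volume preserving maps `T`, the normalized
second moment is minimized by the identity. -/
def IsIsotropic {n : ℕ} (K : Set (EuclideanSpace ℝ (Fin n))) : Prop :=
  ∀ T : EuclideanSpace ℝ (Fin n) ≃ᵃ[ℝ] EuclideanSpace ℝ (Fin n),
    IsVolumePreservingAffine T →
      normalizedSecondMoment K (AffineEquiv.refl ℝ (EuclideanSpace ℝ (Fin n))) ≤
        normalizedSecondMoment K T

/-- `L` is an isotropic constant of `K`: it is positive and, for some isotropic position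
`K' = u(K)` of `K` with uniform density `f = 1_{K'} / |K'|`, every unit vector `θ` satisfies
`L² = ‖f‖^{2/n} ∫ ⟨x, θ⟩² f(x) dx`, where `‖f‖ = sup f = 1 / |K'|`. -/
def IsIsotropicConstant {n : ℕ} (K : Set (EuclideanSpace ℝ (Fin n))) (L : ℝ) : Prop :=
  0 < L ∧
    ∃ u : EuclideanSpace ℝ (Fin n) ≃ᵃ[ℝ] EuclideanSpace ℝ (Fin n),
      IsVolumePreservingAffine u ∧ IsIsotropic (u '' K) ∧
        ∀ θ : EuclideanSpace ℝ (Fin n), ‖θ‖ = 1 →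
          L ^ 2 = ((volume.real (u '' K))⁻¹) ^ ((2 : ℝ) / (n : ℝ)) *
            ((volume.real (u '' K))⁻¹ * ∫ x in u '' K, (inner ℝ x θ) ^ 2)

/-- The isotropic constant `L_K` (the set below is a singleton when `K` is a convex body with
nonempty interior in dimension at least one). -/
noncomputable def isotropicConstant {n : ℕ} (K : Set (EuclideanSpace ℝ (Fin n))) : ℝ :=
  sInf {L : ℝ | IsIsotropicConstant K L}

/-! Let X and Y be independent and uniform on the isotropic bodies, and let f be the density of X +
Y, a multiple of the convolution of the two indicators. Isotropic bodies are centred, so E|X + Y|² =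
E|X|² + E|Y|², and each term divided by n is L²|K|^{2/n} for the corresponding body. It remains to
bound the volume of the support S = A + B by the second moment of f.

Convexity gives f(ax + by) ≥ aⁿ f(x) on S for a + b = 1 (`pow_mul_volume_inter_sub_le`).
Prékopa–Leindler with exponents 1 - 2t, 2t and weights 1 - t, t, applied to a power of f and the
indicator of S, gives to first order as t → 0 that log|S| ≤ n log 2 plus the entropy of f. Among
densities of given second moment the Gaussian has the largest entropy, (n/2) log(2πev). Together
these give |S|^{2/n} ≤ 4 · 2πev (`log_volume_le`). The entropy itself never appears: ∫ f^{1+ε}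
stands in for it.

The isotropic constant is handled by variations of a minimizer: translations show that the body is
centred, and transvections that its second moment is the same in all directions. A minimizer exists
because the second moment is a coercive quadratic form in the affine map. -/

/-! ### Brunn–Minkowski on the line -/

theorem volume_add_le_volume_add_of_isCompact {K L : Set ℝ} (hK : IsCompact K) (hL : IsCompact L)
    (hK0 : K.Nonempty) (hL0 : L.Nonempty) : volume K + volume L ≤ volume (K + L) := by
  have ha := hK.sSup_mem hK0
  have hb := hL.sInf_mem hL0
  set a := sSup K
  set b := sInf L
  -- One translate lies to the left of `a + b` and the other to the right, so inside `K + L` they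
  -- overlap in at most that point.
  have hU : (fun x => x + b) '' K ⊆ K + L := by
    rintro _ ⟨x, hx, rfl⟩; exact Set.add_mem_add hx hb
  have hV : (fun x => a + x) '' L ⊆ K + L := by
    rintro _ ⟨x, hx, rfl⟩; exact Set.add_mem_add ha hx
  have hI : volume ((fun x => x + b) '' K ∩ (fun x => a + x) '' L) = 0 := by
    refine measure_mono_null (t := {a + b}) ?_ (by simp)
    rintro _ ⟨⟨x, hx, rfl⟩, ⟨y, hy, hxy⟩⟩
    have h1 : x ≤ a := le_csSup hK.bddAbove hx
    have h2 : b ≤ y := csInf_le hL.bddBelow hy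
    simp only [Set.mem_singleton_iff] at *
    linarith
  have h := measure_union_add_inter (μ := (volume : Measure ℝ)) ((fun x => x + b) '' K)
    (hL.image (continuous_const_add a)).measurableSet
  rw [hI, add_zero] at h
  have e1 : volume ((fun x => x + b) '' K) = volume K := by
    rw [Set.image_add_right, measure_preimage_add_right]
  have e2 : volume ((fun x => a + x) '' L) = volume L := by
    rw [Set.image_add_left, measure_preimage_add]
  rw [e1, e2] at h
  rw [← h]
  exact measure_mono (Set.union_subset hU hV)

/-- The one-dimensional Brunn–Minkowski inequality. -/
theorem Real.volume_add_volume_le_volume_add {A B : Set ℝ} (hA : MeasurableSet A)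
    (hB : MeasurableSet B) (hA0 : A.Nonempty) (hB0 : B.Nonempty) :
    volume A + volume B ≤ volume (A + B) := by
  obtain ⟨a, ha⟩ := hA0
  obtain ⟨b, hb⟩ := hB0
  rw [hA.measure_eq_iSup_isCompact, hB.measure_eq_iSup_isCompact]
  simp only [iSup_and']
  refine ENNReal.biSup_add_biSup_le' ⟨∅, by simp⟩ ⟨∅, by simp⟩ ?_
  rintro K ⟨hK, hKc⟩ L ⟨hL, hLc⟩
  -- The approximating compact sets may be empty; adjoining `a` and `b` makes them nonempty.
  have := volume_add_le_volume_add_of_isCompact (hKc.insert a) (hLc.insert b) (by simp) (by simp)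
  refine le_trans (add_le_add (measure_mono (Set.subset_insert a K))
    (measure_mono (Set.subset_insert b L))) (this.trans (measure_mono ?_))
  exact Set.add_subset_add (Set.insert_subset ha hK) (Set.insert_subset hb hL)

/-! ### The Prékopa–Leindler inequality -/

theorem ENNReal.geom_mean_le_arith_mean_two {p q : ℝ} (hp : 0 < p) (hq : 0 < q) (hpq : p + q = 1)
    (a b : ENNReal) :
    a ^ p * b ^ q ≤ ENNReal.ofReal p * a + ENNReal.ofReal q * b := by
  rcases eq_or_ne a ⊤ with rfl | ha
  · rw [ENNReal.mul_top (by simpa using hp)]; simp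
  rcases eq_or_ne b ⊤ with rfl | hb
  · rw [ENNReal.mul_top (by simpa using hq)]; simp
  lift a to NNReal using ha
  lift b to NNReal using hb
  lift p to NNReal using hp.le
  lift q to NNReal using hq.le
  have := NNReal.geom_mean_le_arith_mean2_weighted p q a b (by exact_mod_cast hpq)
  rw [ENNReal.ofReal_coe_nnreal, ENNReal.ofReal_coe_nnreal,
    ← ENNReal.coe_rpow_of_nonneg _ p.coe_nonneg, ← ENNReal.coe_rpow_of_nonneg _ q.coe_nonneg]
  exact_mod_cast this

/-- Layer cake formula for functions with values in `ℝ≥0∞`. -/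
theorem lintegral_eq_lintegral_meas_ofReal_lt {α : Type*} [MeasurableSpace α] (μ : Measure α)
    [SFinite μ] {f : α → ENNReal} (hf : Measurable f) :
    ∫⁻ x, f x ∂μ = ∫⁻ t in Set.Ioi (0 : ℝ), μ {x | ENNReal.ofReal t < f x} := by
  have hm : MeasurableSet {z : α × ℝ | ENNReal.ofReal z.2 < f z.1} :=
    measurableSet_lt (by fun_prop) (by fun_prop)
  have key : ∀ x, f x = ∫⁻ t in Set.Ioi (0 : ℝ),
      {z : α × ℝ | ENNReal.ofReal z.2 < f z.1}.indicator 1 (x, t) := by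
    intro x
    have : (fun t : ℝ => {z : α × ℝ | ENNReal.ofReal z.2 < f z.1}.indicator
        (1 : α × ℝ → ENNReal) (x, t)) = {t : ℝ | ENNReal.ofReal t < f x}.indicator 1 := by
      ext t; simp [Set.indicator_apply]
    rw [this, lintegral_indicator_one (measurableSet_lt (by fun_prop) (by fun_prop)),
      Measure.restrict_apply (measurableSet_lt (by fun_prop) (by fun_prop))]
    rcases eq_or_ne (f x) ⊤ with h | h
    · simp [h]
    · have : {t : ℝ | ENNReal.ofReal t < f x} ∩ Set.Ioi 0 = Set.Ioo 0 (f x).toReal := by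
        ext t
        simp only [Set.mem_inter_iff, Set.mem_ofPred_eq, Set.mem_Ioi, Set.mem_Ioo]
        constructor
        · rintro ⟨h1, h2⟩
          exact ⟨h2, (ENNReal.ofReal_lt_iff_lt_toReal h2.le h).1 h1⟩
        · rintro ⟨h1, h2⟩
          exact ⟨(ENNReal.ofReal_lt_iff_lt_toReal h1.le h).2 h2, h1⟩
      rw [this]; simp [h]
  rw [lintegral_congr key]
  rw [lintegral_lintegral_swap]
  · congr 1; ext t
    rw [← lintegral_indicator_one (measurableSet_lt measurable_const hf)]
    congr 1
  · exact (measurable_one.indicator hm).aemeasurable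

/-- One-dimensional Prékopa–Leindler inequality for functions with supremum one. -/
theorem prekopa_leindler_real_of_iSup_eq_one {p q : ℝ} (hp : 0 < p) (hq : 0 < q) (hpq : p + q = 1)
    {f g h : ℝ → ENNReal} (hf : Measurable f) (hg : Measurable g) (hh : Measurable h)
    (hle : ∀ x y, f x ^ p * g y ^ q ≤ h (p * x + q * y))
    (hf1 : ⨆ x, f x = 1) (hg1 : ⨆ x, g x = 1) :
    (∫⁻ x, f x) ^ p * (∫⁻ x, g x) ^ q ≤ ∫⁻ x, h x := by
  refine (ENNReal.geom_mean_le_arith_mean_two hp hq hpq _ _).trans ?_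
  rw [lintegral_eq_lintegral_meas_ofReal_lt _ hf, lintegral_eq_lintegral_meas_ofReal_lt _ hg,
    lintegral_eq_lintegral_meas_ofReal_lt _ hh, ← lintegral_const_mul' _ _ ENNReal.ofReal_ne_top,
    ← lintegral_const_mul' _ _ ENNReal.ofReal_ne_top, ← lintegral_add_left]
  · refine setLIntegral_mono' measurableSet_Ioi fun t ht => ?_
    -- Brunn–Minkowski needs both superlevel sets nonempty. With suprema equal to one they are
    -- nonempty for `t < 1` and both empty for `t ≥ 1`.
    rcases lt_or_ge t 1 with h1 | h1
    · have ht1 : ENNReal.ofReal t < 1 := by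
        rw [← ENNReal.ofReal_one]; exact (ENNReal.ofReal_lt_ofReal_iff one_pos).2 h1
      have hF : MeasurableSet {x | ENNReal.ofReal t < f x} := measurableSet_lt measurable_const hf
      have hG : MeasurableSet {x | ENNReal.ofReal t < g x} := measurableSet_lt measurable_const hg
      have hF0 : {x | ENNReal.ofReal t < f x}.Nonempty :=
        Set.nonempty_def.2 (by simpa using lt_iSup_iff.1 (ht1.trans_eq hf1.symm))
      have hG0 : {x | ENNReal.ofReal t < g x}.Nonempty :=
        Set.nonempty_def.2 (by simpa using lt_iSup_iff.1 (ht1.trans_eq hg1.symm))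
      have := Real.volume_add_volume_le_volume_add (hF.const_smul₀ p) (hG.const_smul₀ q)
        (hF0.smul_set (a := p)) (hG0.smul_set (a := q))
      rw [Measure.addHaar_smul_of_nonneg _ hp.le, Measure.addHaar_smul_of_nonneg _ hq.le] at this
      simp only [Module.finrank_self, pow_one] at this
      refine this.trans (measure_mono ?_)
      rintro _ ⟨_, ⟨x, hx, rfl⟩, _, ⟨y, hy, rfl⟩, rfl⟩
      refine lt_of_lt_of_le ?_ (hle x y)
      have e : ENNReal.ofReal t = ENNReal.ofReal t ^ p * ENNReal.ofReal t ^ q := by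
        rw [← ENNReal.rpow_add_of_nonneg _ _ hp.le hq.le, hpq, ENNReal.rpow_one]
      rw [e]
      exact ENNReal.mul_lt_mul (ENNReal.rpow_lt_rpow hx hp) (ENNReal.rpow_lt_rpow hy hq)
    · have ht1 : 1 ≤ ENNReal.ofReal t := by
        rw [← ENNReal.ofReal_one]; exact ENNReal.ofReal_le_ofReal h1
      have e1 : {x | ENNReal.ofReal t < f x} = ∅ := by
        ext x; simpa using (le_iSup f x).trans (hf1.le.trans ht1)
      have e2 : {x | ENNReal.ofReal t < g x} = ∅ := by
        ext x; simpa using (le_iSup g x).trans (hg1.le.trans ht1)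
      simp [e1, e2]
  · refine Measurable.const_mul (Antitone.measurable ?_) _
    intro s t hst
    exact measure_mono fun x hx => (ENNReal.ofReal_le_ofReal hst).trans_lt hx

/-- The Prékopa–Leindler inequality on the real line. -/
theorem prekopa_leindler_real {p q : ℝ} (hp : 0 < p) (hq : 0 < q) (hpq : p + q = 1)
    {f g h : ℝ → ENNReal} (hf : Measurable f) (hg : Measurable g) (hh : Measurable h)
    (hle : ∀ x y, f x ^ p * g y ^ q ≤ h (p * x + q * y)) :
    (∫⁻ x, f x) ^ p * (∫⁻ x, g x) ^ q ≤ ∫⁻ x, h x := by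
  have bdd : ∀ {f g : ℝ → ENNReal}, Measurable f → Measurable g →
      (∀ x y, f x ^ p * g y ^ q ≤ h (p * x + q * y)) → ⨆ x, f x ≠ ⊤ → ⨆ x, g x ≠ ⊤ →
      (∫⁻ x, f x) ^ p * (∫⁻ x, g x) ^ q ≤ ∫⁻ x, h x := by
    intro f g hf hg hle hM hN
    rcases eq_or_ne (⨆ x, f x) 0 with hM0 | hM0
    · have : ∀ x, f x = 0 := fun x => le_antisymm (hM0 ▸ le_iSup f x) bot_le
      simp [this, hp]
    rcases eq_or_ne (⨆ x, g x) 0 with hN0 | hN0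
    · have : ∀ x, g x = 0 := fun x => le_antisymm (hN0 ▸ le_iSup g x) bot_le
      simp [this, hq]
    set M := ⨆ x, f x
    set N := ⨆ x, g x
    -- The inequality is homogeneous: dividing `f` by `M` and `g` by `N` divides both sides by `M ^
    -- p * N ^ q`.
    have key := prekopa_leindler_real_of_iSup_eq_one hp hq hpq
      (f := fun x => M⁻¹ * f x) (g := fun x => N⁻¹ * g x)
      (h := fun x => (M⁻¹ ^ p * N⁻¹ ^ q) * h x) (hf.const_mul _) (hg.const_mul _) (hh.const_mul _)
      (fun x y => by
        rw [ENNReal.mul_rpow_of_nonneg _ _ hp.le, ENNReal.mul_rpow_of_nonneg _ _ hq.le,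
          mul_mul_mul_comm]
        gcongr; exact hle x y)
      (by rw [← ENNReal.mul_iSup, ENNReal.inv_mul_cancel hM0 hM])
      (by rw [← ENNReal.mul_iSup, ENNReal.inv_mul_cancel hN0 hN])
    rw [lintegral_const_mul _ hf, lintegral_const_mul _ hg, lintegral_const_mul _ hh,
      ENNReal.mul_rpow_of_nonneg _ _ hp.le, ENNReal.mul_rpow_of_nonneg _ _ hq.le,
      mul_mul_mul_comm] at key
    refine (ENNReal.mul_le_mul_iff_right ?_ ?_).1 key
    · simp [hM, hN, hM0, hN0, ENNReal.rpow_eq_zero_iff]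
    · exact ENNReal.mul_ne_top (ENNReal.rpow_ne_top_of_nonneg hp.le (by simpa using hM0))
        (ENNReal.rpow_ne_top_of_nonneg hq.le (by simpa using hN0))
  have trunc : ∀ {f : ℝ → ENNReal}, Measurable f →
      Filter.Tendsto (fun k : ℕ => ∫⁻ x, min (f x) k) Filter.atTop (nhds (∫⁻ x, f x)) := by
    intro f hf
    refine lintegral_tendsto_of_tendsto_of_monotone (fun k => (hf.min measurable_const).aemeasurable)
      (Filter.Eventually.of_forall fun x k l hkl => min_le_min_left _ (by exact_mod_cast hkl))
      (Filter.Eventually.of_forall fun x => ?_)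
    have := (tendsto_const_nhds (x := f x)).min ENNReal.tendsto_nat_nhds_top
    simpa using this
  -- Multiplication in `ENNReal` is discontinuous at `(0, ⊤)`, so zero integrals are split off
  -- before the truncation level tends to infinity.
  rcases eq_or_ne (∫⁻ x, f x) 0 with h0 | h0
  · simp [h0, hp]
  rcases eq_or_ne (∫⁻ x, g x) 0 with h0' | h0'
  · simp [h0', hq]
  have lim := ENNReal.Tendsto.mul
    ((ENNReal.continuous_rpow_const (y := p)).tendsto _ |>.comp (trunc hf))
    (Or.inl (by simp [ENNReal.rpow_eq_zero_iff, h0, hp.le, not_lt]))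
    ((ENNReal.continuous_rpow_const (y := q)).tendsto _ |>.comp (trunc hg))
    (Or.inl (by simp [ENNReal.rpow_eq_zero_iff, h0', hq.le, not_lt]))
  refine le_of_tendsto' lim fun k => ?_
  have top : ∀ f : ℝ → ENNReal, ⨆ x, min (f x) (k : ENNReal) ≠ ⊤ := fun f =>
    ne_top_of_le_ne_top (ENNReal.natCast_ne_top k) (iSup_le fun x => min_le_right _ _)
  refine bdd (hf.min measurable_const) (hg.min measurable_const) (fun x y => ?_) (top f) (top g)
  refine le_trans ?_ (hle x y)
  gcongr <;> exact min_le_left _ _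

theorem prekopa_leindler_pi {p q : ℝ} (hp : 0 < p) (hq : 0 < q) (hpq : p + q = 1) (n : ℕ)
    {f g h : (Fin n → ℝ) → ENNReal} (hf : Measurable f) (hg : Measurable g) (hh : Measurable h)
    (hle : ∀ x y, f x ^ p * g y ^ q ≤ h (p • x + q • y)) :
    (∫⁻ x, f x) ^ p * (∫⁻ x, g x) ^ q ≤ ∫⁻ x, h x := by
  induction n with
  | zero =>
    have e : ∀ f : (Fin 0 → ℝ) → ENNReal, ∫⁻ x, f x = f 0 := by
      intro f
      have : ∀ x, f x = f 0 := fun x => congrArg f (Subsingleton.elim _ _)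
      simp only [this, lintegral_const]
      simp [volume_pi]
    rw [e, e, e]
    simpa using hle 0 0
  | succ n ih =>
    set e := (MeasurableEquiv.piFinSuccAbove (fun _ : Fin (n + 1) => ℝ) 0).symm with he
    have hmp : MeasurePreserving e volume volume :=
      (volume_preserving_piFinSuccAbove (fun _ : Fin (n + 1) => ℝ) 0).symm
    have hi : ∀ {f : (Fin (n + 1) → ℝ) → ENNReal}, Measurable f →
        ∫⁻ x, f x = ∫⁻ t, ∫⁻ y, f (e (t, y)) := by
      intro f hf
      rw [← hmp.lintegral_comp hf, Measure.volume_eq_prod]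
      exact lintegral_prod _ (hf.comp e.measurable).aemeasurable
    have hs : ∀ {f : (Fin (n + 1) → ℝ) → ENNReal}, Measurable f →
        Measurable fun t => ∫⁻ y, f (e (t, y)) := fun hf =>
      (hf.comp e.measurable).lintegral_prod_right'
    have hc : ∀ {f : (Fin (n + 1) → ℝ) → ENNReal}, Measurable f →
        ∀ t, Measurable fun y => f (e (t, y)) := fun hf t =>
      hf.comp (e.measurable.comp measurable_prodMk_left)
    rw [hi hf, hi hg, hi hh]
    -- The line case is applied to the integrals over slices; the induction hypothesis on slices
    -- supplies its pointwise assumption.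
    refine prekopa_leindler_real hp hq hpq (hs hf) (hs hg) (hs hh) fun s t => ?_
    refine ih (hc hf s) (hc hg t) (hc hh _) fun x y => (hle _ _).trans_eq ?_
    congr 1
    ext i
    refine Fin.cases ?_ (fun j => ?_) i <;>
      simp [he, MeasurableEquiv.piFinSuccAbove, Fin.insertNthEquiv]

/-- The Prékopa–Leindler inequality in Euclidean space. -/
theorem prekopa_leindler {p q : ℝ} (hp : 0 < p) (hq : 0 < q) (hpq : p + q = 1) {n : ℕ}
    {f g h : EuclideanSpace ℝ (Fin n) → ENNReal} (hf : Measurable f) (hg : Measurable g)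
    (hh : Measurable h) (hle : ∀ x y, f x ^ p * g y ^ q ≤ h (p • x + q • y)) :
    (∫⁻ x, f x) ^ p * (∫⁻ x, g x) ^ q ≤ ∫⁻ x, h x := by
  have hmp := PiLp.volume_preserving_toLp (Fin n)
  rw [← hmp.lintegral_comp hf, ← hmp.lintegral_comp hg, ← hmp.lintegral_comp hh]
  refine prekopa_leindler_pi hp hq hpq n (hf.comp hmp.measurable) (hg.comp hmp.measurable)
    (hh.comp hmp.measurable) fun x y => ?_
  simpa using hle (WithLp.toLp 2 x) (WithLp.toLp 2 y)

/-- The Prékopa–Leindler inequality with weights `a, b` in the hypothesis that are unrelated to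
the exponents `p, q`. -/
theorem prekopa_leindler_weighted {p q a b : ℝ} (hp : 0 < p) (hq : 0 < q) (hpq : p + q = 1)
    (ha : 0 < a) (hb : 0 < b) {n : ℕ}
    {f g h : EuclideanSpace ℝ (Fin n) → ENNReal} (hf : Measurable f) (hg : Measurable g)
    (hh : Measurable h) (hle : ∀ x y, f x ^ p * g y ^ q ≤ h (a • x + b • y)) :
    (ENNReal.ofReal ((a / p) ^ n) * ∫⁻ x, f x) ^ p * (ENNReal.ofReal ((b / q) ^ n) * ∫⁻ x, g x) ^ q
      ≤ ∫⁻ x, h x := by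
  have scale : ∀ {c : ℝ}, 0 < c → ∀ {f : EuclideanSpace ℝ (Fin n) → ENNReal}, Measurable f →
      ∫⁻ x, f (c⁻¹ • x) = ENNReal.ofReal (c ^ n) * ∫⁻ x, f x := by
    intro c hc f hf
    rw [← lintegral_map hf (measurable_const_smul c⁻¹),
      Measure.map_addHaar_smul _ (inv_ne_zero hc.ne'), lintegral_smul_measure]
    simp [abs_of_pos, hc]
  rw [← scale (div_pos ha hp) hf, ← scale (div_pos hb hq) hg]
  refine prekopa_leindler hp hq hpq (hf.comp (measurable_const_smul _))
    (hg.comp (measurable_const_smul _)) hh fun x y => (hle _ _).trans_eq ?_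
  congr 2 <;> rw [smul_smul] <;> congr 1 <;> field_simp

/-! ### Entropy comparison and the volume of the support -/

/-- Gaussians minimise the Rényi-type functional `∫ f ^ (1 + ε)` to first order in `ε`, among
probability densities of given second moment. -/
theorem one_sub_mul_le_integral_rpow {n : ℕ} {f : EuclideanSpace ℝ (Fin n) → ℝ} {v ε : ℝ}
    (hv : 0 < v) (hε : 0 ≤ ε) (hf0 : ∀ x, 0 ≤ f x) (hf : Integrable f) (hf1 : ∫ x, f x = 1)
    (hfm : Integrable fun x => ‖x‖ ^ 2 * f x) (hm : ∫ x, ‖x‖ ^ 2 * f x = n * v)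
    (hfε : Integrable fun x => f x ^ (1 + ε)) :
    1 - ε * ((n : ℝ) / 2 * Real.log (2 * Real.pi * v) + n / 2) ≤ ∫ x, f x ^ (1 + ε) := by
  set κ := (n : ℝ) / 2 * Real.log (2 * Real.pi * v) with hκ
  have hb : 0 < (2 * v)⁻¹ := by positivity
  have hg := GaussianFourier.integral_rexp_neg_mul_sq_norm (V := EuclideanSpace ℝ (Fin n)) hb
  have hgauss : ∫ x : EuclideanSpace ℝ (Fin n), Real.exp (-(2 * v)⁻¹ * ‖x‖ ^ 2) = Real.exp κ := by
    rw [hg, Real.rpow_def_of_pos (by positivity), finrank_euclideanSpace_fin, hκ, mul_comm]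
    congr 3
    field_simp
  have hgi : Integrable fun x : EuclideanSpace ℝ (Fin n) =>
      Real.exp (-(2 * v)⁻¹ * ‖x‖ ^ 2) := by
    -- A nonintegrable function has integral 0 by convention, whereas this integral is positive.
    by_contra h
    exact (Real.exp_pos κ).ne (by rw [← hgauss, integral_undef h])
  -- The integrand is `f + ε (f (1 + w) - exp w)`, where `w` is the logarithm of the centred
  -- Gaussian density with covariance `v` times the identity.
  have hlow : ∫ x, (f x + ε * ((1 - κ) * f x - (2 * v)⁻¹ * (‖x‖ ^ 2 * f x)
      - Real.exp (-κ) * Real.exp (-(2 * v)⁻¹ * ‖x‖ ^ 2))) = 1 - ε * (κ + n / 2) := by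
    rw [integral_add hf, integral_const_mul, integral_sub, integral_sub, integral_const_mul,
      integral_const_mul, integral_const_mul, hf1, hm, hgauss, ← Real.exp_add]
    · rw [neg_add_cancel, Real.exp_zero]; field_simp; ring
    · exact hf.const_mul _
    · exact hfm.const_mul _
    · exact (hf.const_mul _).sub (hfm.const_mul _)
    · exact hgi.const_mul _
    · exact (((hf.const_mul _).sub (hfm.const_mul _)).sub (hgi.const_mul _)).const_mul _
  rw [← hlow]
  refine integral_mono (hf.add ((((hf.const_mul _).sub (hfm.const_mul _)).sub
    (hgi.const_mul _)).const_mul _)) hfε fun x => ?_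
  rw [← Real.exp_add]
  rcases (hf0 x).eq_or_lt with h0 | h0
  · simp only [← h0, mul_zero, sub_zero, zero_sub, zero_add]
    rw [Real.zero_rpow (by positivity)]
    have := Real.exp_pos (-κ + -(2 * v)⁻¹ * ‖x‖ ^ 2)
    nlinarith
  · have h1 : f x * (1 + ε * Real.log (f x)) ≤ f x ^ (1 + ε) := by
      rw [Real.rpow_add h0, Real.rpow_one, Real.rpow_def_of_pos h0]
      gcongr
      linarith [Real.add_one_le_exp (Real.log (f x) * ε), mul_comm ε (Real.log (f x))]
    refine le_trans ?_ h1
    set w := -κ + -(2 * v)⁻¹ * ‖x‖ ^ 2 with hw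
    -- Pointwise Gibbs inequality: `exp s ≥ 1 + s` at `s = w - log f`.
    have h2 : f x * (w - Real.log (f x) + 1) ≤ Real.exp w := by
      have := Real.add_one_le_exp (w - Real.log (f x))
      rw [Real.exp_sub, Real.exp_log h0, le_div_iff₀ h0] at this
      linarith
    have h3 : (1 - κ) * f x - (2 * v)⁻¹ * (‖x‖ ^ 2 * f x) - Real.exp w ≤ f x * Real.log (f x) := by
      have : f x * (w - Real.log (f x) + 1) = (1 - κ) * f x - (2 * v)⁻¹ * (‖x‖ ^ 2 * f x)
        - f x * Real.log (f x) := by rw [hw]; ring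
      linarith
    nlinarith [mul_le_mul_of_nonneg_left h3 hε]

/-- The left side vanishes at `t = 0` and has derivative `2 (c - H)` there, all terms in `m`
cancelling. Being nonpositive for small `t > 0`, it cannot have positive slope. -/
theorem le_of_log_inequality {c H : ℝ} {m : ℝ}
    (h : ∀ᶠ t : ℝ in nhdsWithin 0 (Set.Ioi 0),
      (1 - 2 * t) * (m * Real.log (1 - t) - (m + 1) * Real.log (1 - 2 * t)
        + Real.log (1 - 2 * t * (1 + H))) + 2 * t * c + m * Real.log (1 - t) ≤ 0) :
    c ≤ H := by
  set φ : ℝ → ℝ := fun t => (1 - 2 * t) * (m * Real.log (1 - t) - (m + 1) * Real.log (1 - 2 * t)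
        + Real.log (1 - 2 * t * (1 + H))) + 2 * t * c + m * Real.log (1 - t) with hφ
  have lin : ∀ a : ℝ, HasDerivAt (fun t : ℝ => Real.log (1 - a * t)) (-a) 0 := by
    intro a
    have := (((hasDerivAt_id (0 : ℝ)).const_mul a).const_sub 1).log (by simp)
    simpa using this
  have l1 := lin 1
  have l2 := lin 2
  have l3 := lin (2 * (1 + H))
  have d : HasDerivAt φ (2 * (c - H)) 0 := by
    have h1 := ((((hasDerivAt_id (0 : ℝ)).const_mul 2).const_sub 1).mul
      (((l1.const_mul m).sub (l2.const_mul (m + 1))).add l3)).add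
      ((((hasDerivAt_id (0 : ℝ)).const_mul 2).mul_const c)) |>.add (l1.const_mul m)
    refine (h1.congr_deriv ?_).congr_of_eventuallyEq (Filter.Eventually.of_forall fun t => ?_)
    · simp; ring
    · simp only [hφ, Pi.add_apply, Pi.mul_apply, Pi.sub_apply, id]
      rw [one_mul, show 2 * t * (1 + H) = 2 * (1 + H) * t by ring]
  have hs := (hasDerivWithinAt_iff_tendsto_slope' (Set.self_notMem_Ioi)).1
    (d.hasDerivWithinAt (s := Set.Ioi 0))
  have : 2 * (c - H) ≤ 0 := by
    refine le_of_tendsto hs ?_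
    filter_upwards [h, self_mem_nhdsWithin] with t ht ht0
    have h0 : φ 0 = 0 := by simp [hφ]
    rw [slope_def_field, h0, sub_zero, sub_zero]
    exact div_nonpos_of_nonpos_of_nonneg ht (le_of_lt ht0)
  linarith

/-- A reverse entropy-type inequality: a density `f` supported in `S` that satisfies
`f (a x + b y) ≥ aⁿ f x` cannot be much more concentrated than the uniform one. -/
theorem log_volume_le {n : ℕ} {S : Set (EuclideanSpace ℝ (Fin n))}
    {f : EuclideanSpace ℝ (Fin n) → ℝ} {v C : ℝ} (hv : 0 < v)
    (hS : MeasurableSet S) (hSb : Bornology.IsBounded S) (hS0 : 0 < volume.real S)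
    (hfm : Measurable f) (hf0 : ∀ x, 0 ≤ f x) (hfC : ∀ x, f x ≤ C) (hfS : ∀ x ∉ S, f x = 0)
    (hconc : ∀ a b : ℝ, 0 < a → 0 < b → a + b = 1 → ∀ x ∈ S, ∀ y ∈ S,
      a ^ n * f x ≤ f (a • x + b • y))
    (hf1 : ∫ x, f x = 1) (hm : ∫ x, ‖x‖ ^ 2 * f x = n * v) :
    Real.log (volume.real S) ≤
      n * Real.log 2 + ((n : ℝ) / 2 * Real.log (2 * Real.pi * v) + n / 2) := by
  set H := (n : ℝ) / 2 * Real.log (2 * Real.pi * v) + n / 2 with hH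
  have hSfin : volume S ≠ ⊤ := hSb.measure_lt_top.ne
  have hint : ∀ {g : EuclideanSpace ℝ (Fin n) → ℝ} (D : ℝ), Measurable g → (∀ x ∉ S, g x = 0) →
      (∀ x ∈ S, ‖g x‖ ≤ D) → Integrable g := by
    intro g D hg h0 hD
    rw [← integrableOn_iff_integrable_of_support_subset (s := S)
      (fun x hx => by_contra fun h => hx (h0 x h))]
    exact Measure.integrableOn_of_bounded hSfin hg.aestronglyMeasurable
      (ae_restrict_of_forall_mem hS hD)
  have hfi : Integrable f := hint C hfm hfS fun x _ => by
    rw [Real.norm_of_nonneg (hf0 x)]; exact hfC x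
  obtain ⟨R, hR⟩ := hSb.exists_norm_le
  have hfi2 : Integrable fun x => ‖x‖ ^ 2 * f x :=
    hint (R ^ 2 * C) (by fun_prop) (fun x hx => by simp [hfS x hx]) fun x hx => by
      rw [Real.norm_of_nonneg (mul_nonneg (by positivity) (hf0 x))]
      exact mul_le_mul (pow_le_pow_left₀ (norm_nonneg x) (hR x hx) 2) (hfC x) (hf0 x)
        (by positivity)
  have hfie : ∀ ε : ℝ, 0 ≤ ε → Integrable fun x => f x ^ (1 + ε) := fun ε hε =>
    hint (C ^ (1 + ε)) (by fun_prop) (fun x hx => by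
        rw [hfS x hx, Real.zero_rpow (by positivity)]) fun x hx => by
      rw [Real.norm_of_nonneg (Real.rpow_nonneg (hf0 x) _)]
      exact Real.rpow_le_rpow (hf0 x) (hfC x) (by positivity)
  have hlow := fun ε (hε : 0 ≤ ε) =>
    one_sub_mul_le_integral_rpow hv hε hf0 hfi hf1 hfi2 hm (hfie ε hε)
  -- The logarithm of Prékopa–Leindler, with the integral of the power of `f` replaced by its
  -- Gaussian lower bound.
  have main : ∀ t : ℝ, 0 < t → 2 * t < 1 → 0 < 1 - 2 * t * (1 + H) →
      (1 - 2 * t) * ((n : ℝ) * Real.log (1 - t) - (n + 1) * Real.log (1 - 2 * t)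
        + Real.log (1 - 2 * t * (1 + H))) + 2 * t * (Real.log (volume.real S) - n * Real.log 2)
        + n * Real.log (1 - t) ≤ 0 := by
    intro t ht ht1 htH
    have hp : 0 < 1 - 2 * t := by linarith
    have hq : 0 < 2 * t := by linarith
    have ha : 0 < 1 - t := by linarith
    set I := ∫ x, f x ^ (1 - 2 * t)⁻¹ with hI
    -- This `ε` makes the exponent the reciprocal of `p = 1 - 2 * t`, so that raising to the power
    -- `p` returns `f`.
    have hexp : 1 + 2 * t / (1 - 2 * t) = (1 - 2 * t)⁻¹ := by field_simp; ring
    have hε : 0 ≤ 2 * t / (1 - 2 * t) := by positivity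
    have hIlow : (1 - 2 * t * (1 + H)) / (1 - 2 * t) ≤ I := by
      have := hlow _ hε
      rw [hexp] at this
      refine le_trans (le_of_eq ?_) this
      field_simp; ring
    have hIi : Integrable fun x => f x ^ (1 - 2 * t)⁻¹ := hexp ▸ hfie _ hε
    have hI0 : 0 < I := lt_of_lt_of_le (by positivity) hIlow
    -- Exponent `q = s * t` with weight `t` on `y` would give the excess `n (log s - 1 + 2 / s)`
    -- over `H`; `s = 2` minimizes it, with value `n log 2`.
    have PL := prekopa_leindler_weighted hp hq (by ring) ha ht
      (f := fun x => ENNReal.ofReal (f x ^ (1 - 2 * t)⁻¹)) (g := S.indicator 1)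
      (h := fun x => ENNReal.ofReal (((1 - t) ^ n)⁻¹ * f x)) (by fun_prop)
      (measurable_one.indicator hS) (by fun_prop) (fun x y => by
        by_cases hy : y ∈ S
        · simp only [Set.indicator_of_mem hy, Pi.one_apply, ENNReal.one_rpow, mul_one]
          rw [ENNReal.ofReal_rpow_of_nonneg (Real.rpow_nonneg (hf0 x) _) hp.le,
            Real.rpow_inv_rpow (hf0 x) hp.ne']
          refine ENNReal.ofReal_le_ofReal ?_
          by_cases hx : x ∈ S
          · rw [le_inv_mul_iff₀ (by positivity)]
            exact hconc _ _ ha ht (by ring) x hx y hy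
          · rw [hfS x hx]; exact mul_nonneg (by positivity) (hf0 _)
        · simp [Set.indicator_of_notMem hy, ENNReal.zero_rpow_of_pos hq])
    rw [lintegral_indicator_one hS, ← ofReal_integral_eq_lintegral_ofReal hIi
      (Filter.Eventually.of_forall fun x => Real.rpow_nonneg (hf0 x) _),
      ← ofReal_integral_eq_lintegral_ofReal (hfi.const_mul _)
      (Filter.Eventually.of_forall fun x => mul_nonneg (by positivity) (hf0 x)),
      integral_const_mul, hf1, ← ofReal_measureReal hSfin,
      ← ENNReal.ofReal_mul (by positivity), ← ENNReal.ofReal_mul (by positivity),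
      ENNReal.ofReal_rpow_of_pos (by positivity),
      ENNReal.ofReal_rpow_of_pos (mul_pos (by positivity) hS0),
      ← ENNReal.ofReal_mul (by positivity), ENNReal.ofReal_le_ofReal_iff (by positivity)] at PL
    rw [← hI] at PL
    have hlog := Real.log_le_log (by positivity) PL
    rw [Real.log_mul (by positivity) (by positivity), Real.log_rpow (by positivity),
      Real.log_rpow (by positivity), Real.log_mul (by positivity) (by positivity),
      Real.log_mul (by positivity) (by positivity), mul_one, Real.log_inv, Real.log_pow,
      Real.log_pow, Real.log_pow, Real.log_div ha.ne' hp.ne',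
      show t / (2 * t) = 2⁻¹ by field_simp, Real.log_inv] at hlog
    have hlogI := Real.log_le_log (by positivity) hIlow
    rw [Real.log_div htH.ne' hp.ne'] at hlogI
    have := mul_le_mul_of_nonneg_left hlogI hp.le
    linarith
  have : Real.log (volume.real S) - n * Real.log 2 ≤ H := by
    refine le_of_log_inequality (m := n) ?_
    have e1 : ∀ᶠ t : ℝ in nhdsWithin 0 (Set.Ioi 0), 2 * t < 1 :=
      ((continuous_const_mul (2 : ℝ)).tendsto' 0 0 (by simp)).eventually_lt_const one_pos
        |>.filter_mono nhdsWithin_le_nhds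
    have e2 : ∀ᶠ t : ℝ in nhdsWithin 0 (Set.Ioi 0), 0 < 1 - 2 * t * (1 + H) :=
      ((by fun_prop : Continuous fun t : ℝ => 1 - 2 * t * (1 + H)).tendsto' 0 1
        (by simp)).eventually_const_lt one_pos |>.filter_mono nhdsWithin_le_nhds
    filter_upwards [e1, e2, self_mem_nhdsWithin] with t h1 h2 h3
    exact main t h3 h1 h2
  linarith

/-! ### The convolution of two convex bodies -/

/-- Tonelli and translation invariance: the volume on the left is the convolution of the indicators
of `A` and `B` at `z`. This makes moments of the sum computable on `A × B`. -/
theorem lintegral_mul_volume_inter_sub {E : Type*} [NormedAddCommGroup E] [InnerProductSpace ℝ E]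
    [FiniteDimensional ℝ E] [MeasurableSpace E] [BorelSpace E] {A B : Set E}
    (hA : MeasurableSet A) (hB : MeasurableSet B) {g : E → ENNReal} (hg : Measurable g) :
    ∫⁻ z, g z * volume (A ∩ {a | z - a ∈ B}) = ∫⁻ a in A, ∫⁻ b in B, g (a + b) := by
  have hind : ∀ z, volume (A ∩ {a | z - a ∈ B}) =
      ∫⁻ a, A.indicator 1 a * B.indicator (1 : E → ENNReal) (z - a) := by
    intro z
    have hm : MeasurableSet (A ∩ {a | z - a ∈ B}) :=
      hA.inter (hB.preimage (measurable_const.sub measurable_id))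
    rw [← lintegral_indicator_one hm]
    congr 1; ext a
    by_cases h1 : a ∈ A <;> by_cases h2 : z - a ∈ B <;> simp [h1, h2]
  have hmeas : Measurable fun p : E × E =>
      g p.1 * (A.indicator 1 p.2 * B.indicator (1 : E → ENNReal) (p.1 - p.2)) :=
    (hg.comp measurable_fst).mul (((measurable_one.indicator hA).comp measurable_snd).mul
      ((measurable_one.indicator hB).comp (measurable_fst.sub measurable_snd)))
  calc ∫⁻ z, g z * volume (A ∩ {a | z - a ∈ B})
      = ∫⁻ z, ∫⁻ a, g z * (A.indicator 1 a * B.indicator (1 : E → ENNReal) (z - a)) := by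
        refine lintegral_congr fun z => ?_
        rw [hind, lintegral_const_mul]
        exact (measurable_one.indicator hA).mul
          ((measurable_one.indicator hB).comp (measurable_const.sub measurable_id))
    _ = ∫⁻ a, ∫⁻ z, g z * (A.indicator 1 a * B.indicator (1 : E → ENNReal) (z - a)) :=
        lintegral_lintegral_swap hmeas.aemeasurable
    _ = ∫⁻ a, A.indicator (fun a => ∫⁻ b in B, g (a + b)) a := by
        refine lintegral_congr fun a => ?_
        by_cases ha : a ∈ A
        · simp only [Set.indicator_of_mem ha, Pi.one_apply, one_mul]
          rw [← lintegral_indicator hB, ← lintegral_add_left_eq_self _ a]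
          refine lintegral_congr fun b => ?_
          by_cases hb : b ∈ B <;> simp [hb]
        · simp [Set.indicator_of_notMem ha]
    _ = _ := lintegral_indicator hA _

/-- Write `y = a + b` and let `W` be the slice at `x`. By convexity of `A` and `B`, the slice at `α
• x + β • y` contains `α • W + β • a`, whose volume is `α ^ n` times that of `W`. -/
theorem pow_mul_volume_inter_sub_le {n : ℕ} {A B : Set (EuclideanSpace ℝ (Fin n))}
    (hA : Convex ℝ A) (hB : Convex ℝ B) (hAfin : volume A ≠ ⊤) {α β : ℝ} (hα : 0 < α) (hβ : 0 < β)
    (hαβ : α + β = 1) (x : EuclideanSpace ℝ (Fin n)) {y : EuclideanSpace ℝ (Fin n)}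
    (hy : y ∈ A + B) :
    α ^ n * volume.real (A ∩ {a | x - a ∈ B}) ≤
      volume.real (A ∩ {a | α • x + β • y - a ∈ B}) := by
  obtain ⟨a, ha, b, hb, rfl⟩ := hy
  set W := A ∩ {a | x - a ∈ B}
  have h1 : α ^ n * volume.real W = volume.real ((fun c => c + β • a) '' (α • W)) := by
    rw [measureReal_def, measureReal_def, Set.image_add_right, measure_preimage_add_right,
      Measure.addHaar_smul_of_nonneg _ hα.le, ENNReal.toReal_mul, finrank_euclideanSpace_fin,
      ENNReal.toReal_ofReal (by positivity)]
  rw [h1]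
  refine measureReal_mono ?_ (measure_ne_top_of_subset Set.inter_subset_left hAfin)
  rintro _ ⟨_, ⟨c, ⟨hc, hc'⟩, rfl⟩, rfl⟩
  refine ⟨hA hc ha hα.le hβ.le hαβ, ?_⟩
  have := hB hc' hb hα.le hβ.le hαβ
  simp only [Set.mem_ofPred_eq]
  convert this using 1
  simp only [smul_sub, smul_add]
  abel

/-- If `X`, `Y` are independent and uniform on the convex bodies `A`, `B`, and `Y` is centered,
then `|A + B|^{2/n} ≤ 8πe · E|X + Y|² / n`. -/
theorem volume_add_rpow_le {n : ℕ} (hn : 1 ≤ n) {A B : Set (EuclideanSpace ℝ (Fin n))}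
    (hA : IsCompact A) (hB : IsCompact B) (hAc : Convex ℝ A) (hBc : Convex ℝ B)
    (hA0 : 0 < volume.real A) (hB0 : 0 < volume.real B)
    (hBm : ∀ θ : EuclideanSpace ℝ (Fin n), ∫ b in B, inner ℝ θ b = 0) {v : ℝ} (hv : 0 < v)
    (hmv : n * v = (volume.real A)⁻¹ * (∫ x in A, ‖x‖ ^ 2) +
      (volume.real B)⁻¹ * ∫ x in B, ‖x‖ ^ 2) :
    volume.real (A + B) ^ ((2 : ℝ) / n) ≤ 8 * Real.pi * Real.exp 1 * v := by
  set F : EuclideanSpace ℝ (Fin n) → ℝ := fun z => volume.real (A ∩ {a | z - a ∈ B}) with hF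
  have hAfin : volume A ≠ ⊤ := hA.measure_lt_top.ne
  have hFfin : ∀ z, volume (A ∩ {a | z - a ∈ B}) ≠ ⊤ := fun z =>
    measure_ne_top_of_subset Set.inter_subset_left hAfin
  have hFm : Measurable F := by
    have hs : MeasurableSet
        {p : EuclideanSpace ℝ (Fin n) × EuclideanSpace ℝ (Fin n) | p.2 ∈ A ∧ p.1 - p.2 ∈ B} :=
      (hA.measurableSet.preimage measurable_snd).inter
        (hB.measurableSet.preimage (measurable_fst.sub measurable_snd))
    exact (measurable_measure_prodMk_left (ν := volume) hs).ennreal_toReal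
  have hF0 : ∀ z, 0 ≤ F z := fun z => measureReal_nonneg
  have hint : ∀ {g : EuclideanSpace ℝ (Fin n) → ℝ}, Measurable g → (∀ z, 0 ≤ g z) →
      ∫ z, g z * F z = (∫⁻ a in A, ∫⁻ b in B, ENNReal.ofReal (g (a + b))).toReal := by
    intro g hg hg0
    rw [← lintegral_mul_volume_inter_sub hA.measurableSet hB.measurableSet
      (g := fun z => ENNReal.ofReal (g z)) (by fun_prop),
      integral_eq_lintegral_of_nonneg_ae (Filter.Eventually.of_forall fun z =>
        mul_nonneg (hg0 z) (hF0 z)) (hg.mul hFm).aestronglyMeasurable]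
    congr 2; ext z
    rw [ENNReal.ofReal_mul (hg0 z), hF, ofReal_measureReal (hFfin z)]
  have hint1 : ∫ z, F z = volume.real A * volume.real B := by
    have := hint (g := fun _ => 1) measurable_const (fun _ => zero_le_one)
    simpa [measureReal_def, mul_comm] using this
  -- In the expansion of `‖a + b‖ ^ 2` the cross term integrates to zero because `B` is centred.
  have hint2 : ∫ z, ‖z‖ ^ 2 * F z = volume.real A * volume.real B * (n * v) := by
    rw [hint (by fun_prop) fun z => by positivity]
    have hcont : ∀ {K : Set (EuclideanSpace ℝ (Fin n))}, IsCompact K →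
        ∀ {φ : EuclideanSpace ℝ (Fin n) → ℝ}, Continuous φ → IntegrableOn φ K :=
      fun hK _ hφ => hφ.continuousOn.integrableOn_compact hK
    have inner_int : ∀ a : EuclideanSpace ℝ (Fin n),
        ∫⁻ b in B, ENNReal.ofReal (‖a + b‖ ^ 2) =
          ENNReal.ofReal (volume.real B * ‖a‖ ^ 2 + ∫ b in B, ‖b‖ ^ 2) := by
      intro a
      rw [← ofReal_integral_eq_lintegral_ofReal (hcont hB (by fun_prop))
        (Filter.Eventually.of_forall fun b => by positivity)]
      congr 1
      simp_rw [norm_add_sq_real]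
      rw [integral_add, integral_add, integral_const_mul, hBm, setIntegral_const]
      · simp
      · exact hcont hB (by fun_prop)
      · exact hcont hB (by fun_prop)
      · exact hcont hB (by fun_prop)
      · exact hcont hB (by fun_prop)
    simp_rw [inner_int]
    have hnn : 0 ≤ ∫ b in B, ‖b‖ ^ 2 := integral_nonneg fun b => by positivity
    rw [← ofReal_integral_eq_lintegral_ofReal (hcont hA (by fun_prop))
        (Filter.Eventually.of_forall fun b => by positivity), integral_add, integral_const_mul,
        setIntegral_const, hmv, ENNReal.toReal_ofReal]
    · rw [smul_eq_mul]; field_simp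
    · have : 0 ≤ ∫ b in A, ‖b‖ ^ 2 := integral_nonneg fun b => by positivity
      rw [smul_eq_mul]
      positivity
    · exact hcont hA (by fun_prop)
    · exact hcont hA (by fun_prop)
  have hS : IsCompact (A + B) := hA.add hB
  have hAne : A.Nonempty := Set.nonempty_iff_ne_empty.2 fun h => by simp [h] at hA0
  have hS0 : 0 < volume.real (A + B) := by
    obtain ⟨a, ha⟩ := hAne
    have hsub : (fun b => a + b) '' B ⊆ A + B := by
      rintro _ ⟨b, hb, rfl⟩; exact Set.add_mem_add ha hb
    refine lt_of_lt_of_le ?_ (measureReal_mono hsub hS.measure_lt_top.ne)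
    rwa [measureReal_def, Set.image_add_left, measure_preimage_add]
  have hc : 0 < (volume.real A * volume.real B)⁻¹ := by positivity
  have key := log_volume_le (S := A + B) (f := fun z => (volume.real A * volume.real B)⁻¹ * F z)
    (C := (volume.real A * volume.real B)⁻¹ * volume.real A)
    hv hS.measurableSet hS.isBounded hS0 (hFm.const_mul _)
    (fun z => mul_nonneg hc.le (hF0 z))
    (fun z => mul_le_mul_of_nonneg_left (measureReal_mono Set.inter_subset_left hAfin) hc.le)
    (fun z hz => by
      have : A ∩ {a | z - a ∈ B} = ∅ := by
        refine Set.eq_empty_iff_forall_notMem.2 fun a ha => hz ?_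
        exact ⟨a, ha.1, z - a, ha.2, by simp⟩
      simp [hF, this])
    (fun a b ha hb hab x _ y hy => by
      have := pow_mul_volume_inter_sub_le hAc hBc hAfin ha hb hab x hy
      rw [mul_left_comm]
      exact mul_le_mul_of_nonneg_left this hc.le)
    (by rw [integral_const_mul, hint1]; field_simp)
    (by
      simp_rw [mul_left_comm (_ ^ 2) (_⁻¹) _]
      rw [integral_const_mul, hint2]; field_simp)
  have hn0 : (0 : ℝ) < n := by exact_mod_cast hn
  rw [← Real.log_le_log_iff (by positivity) (by positivity), Real.log_rpow hS0]
  have h8 : Real.log (8 * Real.pi * Real.exp 1 * v) =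
      2 * Real.log 2 + Real.log (2 * Real.pi * v) + 1 := by
    rw [show 8 * Real.pi * Real.exp 1 * v = 2 ^ 2 * (2 * Real.pi * v) * Real.exp 1 by ring,
      Real.log_mul (by positivity) (by positivity), Real.log_mul (by positivity) (by positivity),
      Real.log_exp, Real.log_pow]
    norm_num
  rw [h8]
  calc 2 / (n : ℝ) * Real.log (volume.real (A + B))
      ≤ 2 / n * (n * Real.log 2 + ((n : ℝ) / 2 * Real.log (2 * Real.pi * v) + n / 2)) := by gcongr
    _ = _ := by field_simp; ring

/-! ### Volume preserving affine maps -/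

theorem AffineEquiv.apply_eq_linear_add {E : Type*} [AddCommGroup E] [Module ℝ E]
    (T : E ≃ᵃ[ℝ] E) (x : E) : T x = T.linear x + T 0 := by
  simpa using T.map_vadd 0 x

theorem isVolumePreservingAffine_iff {n : ℕ}
    {T : EuclideanSpace ℝ (Fin n) ≃ᵃ[ℝ] EuclideanSpace ℝ (Fin n)} :
    IsVolumePreservingAffine T ↔ |LinearMap.det (T.linear : EuclideanSpace ℝ (Fin n) →ₗ[ℝ] _)| = 1 := by
  set f : EuclideanSpace ℝ (Fin n) →ₗ[ℝ] EuclideanSpace ℝ (Fin n) := ↑T.linear with hf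
  have hdet : LinearMap.det f ≠ 0 := T.linear.isUnit_det'.ne_zero
  have hfm : Measurable f := f.continuous_of_finiteDimensional.measurable
  have hT : ⇑T = (fun x => x + T 0) ∘ f := funext fun x => T.apply_eq_linear_add x
  have hmap : Measure.map T volume = ENNReal.ofReal |(LinearMap.det f)⁻¹| • volume := by
    rw [hT, ← Measure.map_map (measurable_add_const _) hfm,
      Measure.map_linearMap_addHaar_eq_smul_addHaar _ hdet, Measure.map_smul,
      map_add_right_eq_self]
  constructor
  · intro h
    have h1 : ENNReal.ofReal |(LinearMap.det f)⁻¹| *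
        volume (Metric.ball (0 : EuclideanSpace ℝ (Fin n)) 1) =
          1 * volume (Metric.ball (0 : EuclideanSpace ℝ (Fin n)) 1) := by
      rw [one_mul, ← smul_eq_mul, ← Measure.smul_apply, ← hmap, h.map_eq]
    have h2 := (ENNReal.mul_left_inj (Metric.measure_ball_pos _ _ one_pos).ne'
      measure_ball_lt_top.ne).1 h1
    rw [ENNReal.ofReal_eq_one, abs_inv, inv_eq_one] at h2
    exact h2
  · intro h
    refine ⟨hT ▸ (measurable_add_const _).comp hfm, ?_⟩
    rw [hmap, abs_inv, h]; simp

theorem IsVolumePreservingAffine.trans {n : ℕ}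
    {S T : EuclideanSpace ℝ (Fin n) ≃ᵃ[ℝ] EuclideanSpace ℝ (Fin n)}
    (hS : IsVolumePreservingAffine S) (hT : IsVolumePreservingAffine T) :
    IsVolumePreservingAffine (S.trans T) :=
  MeasurePreserving.comp (g := T) (f := S) hT hS

theorem AffineEquiv.continuous_euclideanSpace {n : ℕ}
    (T : EuclideanSpace ℝ (Fin n) ≃ᵃ[ℝ] EuclideanSpace ℝ (Fin n)) : Continuous T :=
  T.toAffineMap.continuous_of_finiteDimensional

theorem AffineEquiv.measurableEmbedding {n : ℕ}
    (T : EuclideanSpace ℝ (Fin n) ≃ᵃ[ℝ] EuclideanSpace ℝ (Fin n)) : MeasurableEmbedding T :=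
  T.continuous_euclideanSpace.measurableEmbedding T.injective

theorem IsVolumePreservingAffine.symm {n : ℕ}
    {T : EuclideanSpace ℝ (Fin n) ≃ᵃ[ℝ] EuclideanSpace ℝ (Fin n)}
    (hT : IsVolumePreservingAffine T) : IsVolumePreservingAffine T.symm := by
  refine ⟨T.symm.measurableEmbedding.measurable, ?_⟩
  conv_lhs => rw [← hT.map_eq]
  rw [Measure.map_map T.symm.measurableEmbedding.measurable hT.measurable]
  have : ⇑T.symm ∘ ⇑T = id := funext fun x => T.symm_apply_apply x
  rw [this, Measure.map_id]

theorem IsVolumePreservingAffine.volume_real_image {n : ℕ}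
    {T : EuclideanSpace ℝ (Fin n) ≃ᵃ[ℝ] EuclideanSpace ℝ (Fin n)}
    (hT : IsVolumePreservingAffine T) (K : Set (EuclideanSpace ℝ (Fin n))) :
    volume.real (T '' K) = volume.real K := by
  have := MeasurePreserving.measure_preimage_emb hT T.measurableEmbedding (T '' K)
  rw [Set.preimage_image_eq _ T.injective] at this
  rw [measureReal_def, measureReal_def, this]

theorem normalizedSecondMoment_image {n : ℕ}
    {u : EuclideanSpace ℝ (Fin n) ≃ᵃ[ℝ] EuclideanSpace ℝ (Fin n)}
    (hu : IsVolumePreservingAffine u) (K : Set (EuclideanSpace ℝ (Fin n)))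
    (T : EuclideanSpace ℝ (Fin n) ≃ᵃ[ℝ] EuclideanSpace ℝ (Fin n)) :
    normalizedSecondMoment (u '' K) T = normalizedSecondMoment K (u.trans T) := by
  rw [normalizedSecondMoment, hu.volume_real_image,
    MeasurePreserving.setIntegral_image_emb hu u.measurableEmbedding]
  rfl

/-! ### Isotropic position and the isotropic constant -/

section Isotropic

variable {n : ℕ} {K : Set (EuclideanSpace ℝ (Fin n))}

theorem Continuous.integrableOn_of_isCompact (hK : IsCompact K)
    {φ : EuclideanSpace ℝ (Fin n) → ℝ} (hφ : Continuous φ) : IntegrableOn φ K :=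
  hφ.continuousOn.integrableOn_compact hK

theorem IsIsotropic.setIntegral_norm_sq_le (hn : 1 ≤ n) (hV : 0 < volume.real K)
    (h : IsIsotropic K) {T : EuclideanSpace ℝ (Fin n) ≃ᵃ[ℝ] EuclideanSpace ℝ (Fin n)}
    (hT : IsVolumePreservingAffine T) : ∫ x in K, ‖x‖ ^ 2 ≤ ∫ x in K, ‖T x‖ ^ 2 := by
  have := h T hT
  have hn0 : (0 : ℝ) < n := by exact_mod_cast hn
  simp only [normalizedSecondMoment, AffineEquiv.refl_apply, integral_div] at this
  exact (div_le_div_iff_of_pos_right hn0).1 (le_of_mul_le_mul_left this (by positivity))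

/-- The first-variation principle used for isotropic bodies: the discriminant `4 * b ^ 2` cannot be
positive. -/
theorem eq_zero_of_forall_quadratic_nonneg {a b : ℝ} (h : ∀ t : ℝ, 0 ≤ a * t ^ 2 + 2 * b * t) :
    b = 0 := by
  have h0 : discrim a (2 * b) 0 ≤ 0 := discrim_le_zero fun t => by
    have := h t; rw [add_zero, ← pow_two]; exact this
  rw [discrim] at h0
  nlinarith [sq_nonneg b]

/-- Translating by `t • θ` cannot lower the second moment, so the coefficient of `t` vanishes. -/
theorem IsIsotropic.setIntegral_inner (hn : 1 ≤ n) (hK : IsCompact K) (hV : 0 < volume.real K)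
    (h : IsIsotropic K) (θ : EuclideanSpace ℝ (Fin n)) : ∫ x in K, inner ℝ θ x = 0 := by
  refine eq_zero_of_forall_quadratic_nonneg (a := volume.real K * ‖θ‖ ^ 2) fun t => ?_
  have := h.setIntegral_norm_sq_le hn hV (T := AffineEquiv.constVAdd ℝ _ (t • θ))
    (isVolumePreservingAffine_iff.2 (by simp))
  simp only [AffineEquiv.constVAdd_apply, vadd_eq_add, norm_add_sq_real, inner_smul_left,
    norm_smul, mul_pow] at this
  rw [integral_add, integral_add, integral_const_mul, integral_const_mul, setIntegral_const] at this
  · simp only [conj_trivial, integral_const_mul, smul_eq_mul, Real.norm_eq_abs, sq_abs] at this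
    linarith
  all_goals exact Continuous.integrableOn_of_isCompact hK (by fun_prop)

/-- For orthogonal `u`, `w` the transvection `x ↦ x + t ⟨u, x⟩ w` has determinant one, and the first
variation of the second moment along it is twice this integral. -/
theorem IsIsotropic.setIntegral_inner_mul_inner (hn : 1 ≤ n) (hK : IsCompact K)
    (hV : 0 < volume.real K) (h : IsIsotropic K) {u w : EuclideanSpace ℝ (Fin n)}
    (huw : inner ℝ u w = 0) : ∫ x in K, inner ℝ u x * inner ℝ w x = 0 := by
  refine eq_zero_of_forall_quadratic_nonneg (a := ∫ x in K, (inner ℝ u x * ‖w‖) ^ 2) fun t => ?_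
  have huw' : (innerSL ℝ u : EuclideanSpace ℝ (Fin n) →ₗ[ℝ] ℝ) (t • w) = 0 := by
    simp [huw]
  have := h.setIntegral_norm_sq_le hn hV (T := (LinearEquiv.transvection huw').toAffineEquiv)
    (isVolumePreservingAffine_iff.2 (by
      change |LinearMap.det (LinearMap.transvection _ _)| = 1
      rw [LinearMap.transvection.det, huw', add_zero, abs_one]))
  have e : ∀ x, ‖(LinearEquiv.transvection huw').toAffineEquiv x‖ ^ 2 =
      ‖x‖ ^ 2 + (2 * t) * (inner ℝ u x * inner ℝ w x) + t ^ 2 * (inner ℝ u x * ‖w‖) ^ 2 := by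
    intro x
    have : (LinearEquiv.transvection huw').toAffineEquiv x = x + (inner ℝ u x * t) • w := by
      simp [LinearMap.transvection.apply, smul_smul]
    rw [this, norm_add_sq_real, inner_smul_right, norm_smul, real_inner_comm w x, mul_pow,
      Real.norm_eq_abs, sq_abs]
    ring
  simp only [e] at this
  rw [integral_add, integral_add, integral_const_mul, integral_const_mul] at this
  · linarith
  all_goals exact Continuous.integrableOn_of_isCompact hK (by fun_prop)

theorem IsIsotropic.mul_setIntegral_inner_sq (hn : 1 ≤ n) (hK : IsCompact K)
    (hV : 0 < volume.real K) (h : IsIsotropic K) {θ : EuclideanSpace ℝ (Fin n)} (hθ : ‖θ‖ = 1) :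
    n * ∫ x in K, inner ℝ x θ ^ 2 = ∫ x in K, ‖x‖ ^ 2 := by
  have hθ' : ∀ i : Fin n, ∫ x in K, x i ^ 2 = ∫ x in K, inner ℝ x θ ^ 2 := by
    intro i
    set e : EuclideanSpace ℝ (Fin n) := EuclideanSpace.single i 1
    have he : ‖e‖ = 1 := by simp [e]
    have hx : ∀ x : EuclideanSpace ℝ (Fin n), inner ℝ e x = x i := fun x => by
      simp [e, EuclideanSpace.inner_single_left]
    -- For unit vectors, `e + θ` and `e - θ` are orthogonal, and the product of their pairings with
    -- `x` is `⟨e, x⟩² - ⟨θ, x⟩²`.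
    have := h.setIntegral_inner_mul_inner hn hK hV (u := e + θ) (w := e - θ)
      ((real_inner_add_sub_eq_zero_iff _ _).2 (he.trans hθ.symm))
    rw [← sub_eq_zero, ← this, ← integral_sub]
    · congr 1; ext x
      rw [inner_add_left, inner_sub_left, hx, real_inner_comm]; ring
    all_goals exact Continuous.integrableOn_of_isCompact hK (by fun_prop)
  simp_rw [EuclideanSpace.norm_sq_eq, Real.norm_eq_abs, sq_abs]
  rw [integral_finsetSum]
  · simp [hθ']
  · intro i _
    exact Continuous.integrableOn_of_isCompact hK (by fun_prop)

theorem exists_pos_mul_norm_sq_le {X : Type*} [NormedAddCommGroup X] [NormedSpace ℝ X]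
    [ProperSpace X] {Q : X → ℝ} (hQc : Continuous Q) (hQs : ∀ (t : ℝ) p, Q (t • p) = t ^ 2 * Q p)
    (hQpos : ∀ p, p ≠ 0 → 0 < Q p) : ∃ δ > 0, ∀ p, δ * ‖p‖ ^ 2 ≤ Q p := by
  have hQ0 : Q 0 = 0 := by simpa using hQs 0 0
  have hmem : ∀ p : X, p ≠ 0 → ‖p‖⁻¹ • p ∈ Metric.sphere (0 : X) 1 := fun p hp => by
    rw [mem_sphere_zero_iff_norm, norm_smul, norm_inv, norm_norm,
      inv_mul_cancel₀ (norm_ne_zero_iff.2 hp)]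
  -- The sphere is empty when `X` is trivial; otherwise `δ` is the minimum of `Q` on it.
  rcases (Metric.sphere (0 : X) 1).eq_empty_or_nonempty with he | hne
  · refine ⟨1, one_pos, fun p => ?_⟩
    rcases eq_or_ne p 0 with rfl | hp
    · simp [hQ0]
    · exact absurd (hmem p hp) (by simp [he])
  · obtain ⟨p₀, hp₀, hmin⟩ := (isCompact_sphere (0 : X) 1).exists_isMinOn hne hQc.continuousOn
    refine ⟨Q p₀, hQpos _ fun h => by simp [h] at hp₀, fun p => ?_⟩
    rcases eq_or_ne p 0 with rfl | hp
    · simp [hQ0]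
    · have := hmin (hmem p hp)
      simp only [Set.mem_ofPred_eq, hQs] at this
      have hp' : 0 < ‖p‖ := norm_pos_iff.2 hp
      rwa [inv_pow, le_inv_mul_iff₀ (by positivity), mul_comm] at this

/-- As a function of the linear part and the translation, the second moment is a positive definite
quadratic form, hence coercive, and the constraint `|det| = 1` is closed. -/
theorem exists_isMin_normalizedSecondMoment (hK : IsCompact K) (hK0 : (interior K).Nonempty) :
    ∃ T : EuclideanSpace ℝ (Fin n) ≃ᵃ[ℝ] EuclideanSpace ℝ (Fin n), IsVolumePreservingAffine T ∧
      ∀ T', IsVolumePreservingAffine T' →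
        normalizedSecondMoment K T ≤ normalizedSecondMoment K T' := by
  set Q : (EuclideanSpace ℝ (Fin n) →L[ℝ] EuclideanSpace ℝ (Fin n)) × EuclideanSpace ℝ (Fin n) → ℝ :=
    fun p => ∫ x in K, ‖p.1 x + p.2‖ ^ 2 with hQ
  have hQc : Continuous Q := continuous_parametric_integral_of_continuous (by fun_prop) hK
  have hQnn : ∀ p, 0 ≤ Q p := fun p => integral_nonneg fun x => by positivity
  have hQpos : ∀ p, p ≠ 0 → 0 < Q p := by
    intro p hp
    refine (hQnn p).lt_of_ne' fun h0 => hp ?_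
    have hi : IntegrableOn (fun x => ‖p.1 x + p.2‖ ^ 2) K :=
      Continuous.integrableOn_of_isCompact hK (by fun_prop)
    -- A zero of `Q` is an affine map vanishing almost everywhere on `K`, hence by continuity on the
    -- whole open interior, so its derivative and then its constant term are zero.
    have hae := (setIntegral_eq_zero_iff_of_nonneg_ae
      (Filter.Eventually.of_forall fun x => by positivity) hi).1 h0
    have heq := Measure.eqOn_open_of_ae_eq
      (ae_restrict_of_ae_restrict_of_subset interior_subset hae)
      isOpen_interior (by fun_prop) (by fun_prop)
    have hz : ∀ x ∈ interior K, p.1 x + p.2 = 0 := fun x hx => by simpa using heq hx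
    obtain ⟨x₀, hx₀⟩ := hK0
    have hev : (fun x => p.1 x + p.2) =ᶠ[nhds x₀] fun _ => 0 :=
      (isOpen_interior.mem_nhds hx₀ |> Filter.mem_of_superset) hz
    have h1 : p.1 = 0 := (p.1.hasFDerivAt.add_const p.2).unique
      ((hasFDerivAt_const 0 x₀).congr_of_eventuallyEq hev)
    have h2 : p.2 = 0 := by simpa [h1] using hz x₀ hx₀
    exact Prod.ext h1 h2
  have hQs : ∀ (t : ℝ) p, Q (t • p) = t ^ 2 * Q p := by
    intro t p
    simp only [hQ, ← integral_const_mul]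
    congr 1; ext x
    simp [← smul_add, norm_smul, mul_pow]
  obtain ⟨δ, hδ, hδQ⟩ := exists_pos_mul_norm_sq_le hQc hQs hQpos
  have hdet : Continuous fun p : (EuclideanSpace ℝ (Fin n) →L[ℝ] EuclideanSpace ℝ (Fin n)) × EuclideanSpace ℝ (Fin n) =>
      |p.1.det| :=
    (ContinuousLinearMap.continuous_det.comp continuous_fst).abs
  have hcomp : IsCompact ({p : (EuclideanSpace ℝ (Fin n) →L[ℝ] EuclideanSpace ℝ (Fin n)) × EuclideanSpace ℝ (Fin n) |
      |p.1.det| = 1} ∩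
      {p | Q p ≤ Q (ContinuousLinearMap.id ℝ (EuclideanSpace ℝ (Fin n)), 0)}) := by
    refine Metric.isCompact_of_isClosed_isBounded
      ((isClosed_eq hdet continuous_const).inter (isClosed_le hQc continuous_const)) ?_
    refine isBounded_iff_forall_norm_le.2
      ⟨√(Q (ContinuousLinearMap.id ℝ (EuclideanSpace ℝ (Fin n)), 0) / δ), ?_⟩
    rintro p ⟨-, hp⟩
    refine Real.le_sqrt_of_sq_le ?_
    rw [le_div_iff₀ hδ, mul_comm]
    exact (hδQ p).trans hp
  obtain ⟨p, ⟨hp1, hp2⟩, hmin⟩ := hcomp.exists_isMinOn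
    ⟨(ContinuousLinearMap.id ℝ (EuclideanSpace ℝ (Fin n)), 0), by simp [ContinuousLinearMap.det],
      le_refl (Q _)⟩ hQc.continuousOn
  have hpd : LinearMap.det (p.1 : EuclideanSpace ℝ (Fin n) →ₗ[ℝ] EuclideanSpace ℝ (Fin n)) ≠ 0 :=
      fun h => by
    have : |p.1.det| = 1 := hp1
    rw [ContinuousLinearMap.det, h] at this
    simp at this
  set T : EuclideanSpace ℝ (Fin n) ≃ᵃ[ℝ] EuclideanSpace ℝ (Fin n) :=
    (LinearMap.equivOfDetNeZero _ hpd).toAffineEquiv.trans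
    (AffineEquiv.constVAdd ℝ (EuclideanSpace ℝ (Fin n)) p.2) with hT
  have hTx : ∀ x, T x = p.1 x + p.2 := fun x => by
    change p.2 + p.1 x = _
    rw [add_comm]
  have hTl : (T.linear : EuclideanSpace ℝ (Fin n) →ₗ[ℝ] EuclideanSpace ℝ (Fin n)) = p.1 := by
    ext1 x
    have := T.apply_eq_linear_add x
    rw [hTx, hTx 0] at this
    simpa using this.symm
  have hnsm : ∀ S : EuclideanSpace ℝ (Fin n) ≃ᵃ[ℝ] EuclideanSpace ℝ (Fin n), normalizedSecondMoment K S =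
      (volume.real K)⁻¹ *
      (Q (LinearMap.toContinuousLinearMap (S.linear : EuclideanSpace ℝ (Fin n) →ₗ[ℝ] _), S 0) / n) := by
    intro S
    rw [normalizedSecondMoment, integral_div]
    simp only [hQ, LinearMap.coe_toContinuousLinearMap', LinearEquiv.coe_coe,
      ← S.apply_eq_linear_add]
  refine ⟨T, isVolumePreservingAffine_iff.2 (hTl ▸ hp1), fun T' hT' => ?_⟩
  -- Pairs outside the compact sublevel set already do no better than the identity.
  have hle : ∀ p', |p'.1.det| = 1 → Q p ≤ Q p' := by
    intro p' hp'
    rcases le_total (Q p') (Q (ContinuousLinearMap.id ℝ (EuclideanSpace ℝ (Fin n)), 0)) with h | h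
    · exact hmin ⟨hp', h⟩
    · exact hp2.trans h
  rw [hnsm, hnsm]
  have e : (LinearMap.toContinuousLinearMap (T.linear : EuclideanSpace ℝ (Fin n) →ₗ[ℝ] _), T 0) = p := by
    refine Prod.ext ?_ (by simp [hTx])
    rw [hTl]; rfl
  rw [e]
  gcongr
  exact hle _ (isVolumePreservingAffine_iff.1 hT')

theorem IsIsotropic.normalizedSecondMoment_eq (hn : 1 ≤ n) (hK : IsCompact K)
    (hV : 0 < volume.real K) (h : IsIsotropic K) {θ : EuclideanSpace ℝ (Fin n)} (hθ : ‖θ‖ = 1) :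
    normalizedSecondMoment K (AffineEquiv.refl ℝ _) =
      (volume.real K)⁻¹ * ∫ x in K, inner ℝ x θ ^ 2 := by
  have hn0 : (0 : ℝ) < n := by exact_mod_cast hn
  simp only [normalizedSecondMoment, AffineEquiv.refl_apply, integral_div]
  rw [← h.mul_setIntegral_inner_sq hn hK hV hθ]
  field_simp

theorem volume_real_pos_of_isCompact (hK : IsCompact K) (hK0 : (interior K).Nonempty) :
    0 < volume.real K :=
  ENNReal.toReal_pos (Measure.measure_pos_of_nonempty_interior _ hK0).ne' hK.measure_lt_top.ne

theorem normalizedSecondMoment_refl_pos (hn : 1 ≤ n) (hK : IsCompact K)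
    (hK0 : (interior K).Nonempty) : 0 < normalizedSecondMoment K (AffineEquiv.refl ℝ _) := by
  have hn0 : (0 : ℝ) < n := by exact_mod_cast hn
  have : Nontrivial (EuclideanSpace ℝ (Fin n)) :=
    Module.nontrivial_of_finrank_pos (R := ℝ) (by rw [finrank_euclideanSpace_fin]; exact hn)
  have hV := volume_real_pos_of_isCompact hK hK0
  simp only [normalizedSecondMoment, AffineEquiv.refl_apply, integral_div]
  refine mul_pos (inv_pos.2 hV) (div_pos ?_ hn0)
  rw [setIntegral_pos_iff_support_of_nonneg_ae
    (Filter.Eventually.of_forall fun x => by positivity)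
    (Continuous.integrableOn_of_isCompact hK (by fun_prop))]
  have hsupp : Function.support (fun x : EuclideanSpace ℝ (Fin n) => ‖x‖ ^ 2) = {0}ᶜ := by
    ext x; simp
  rw [hsupp, Set.inter_comm, ← Set.sdiff_eq, measure_sdiff_null (measure_singleton _)]
  exact Measure.measure_pos_of_nonempty_interior _ hK0

theorem interior_image_nonempty (hK0 : (interior K).Nonempty)
    (u : EuclideanSpace ℝ (Fin n) ≃ᵃ[ℝ] EuclideanSpace ℝ (Fin n)) :
    (interior (u '' K)).Nonempty := by
  have : u '' interior K = interior (u '' K) :=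
    u.toContinuousAffineEquiv.toHomeomorph.image_interior K
  exact this ▸ hK0.image _

theorem exists_norm_eq_one_of_one_le (hn : 1 ≤ n) : ∃ θ : EuclideanSpace ℝ (Fin n), ‖θ‖ = 1 :=
  ⟨EuclideanSpace.single ⟨0, hn⟩ 1, by simp⟩

theorem exists_isIsotropicConstant (hn : 1 ≤ n) (hK : IsCompact K) (hK0 : (interior K).Nonempty) :
    ∃ L, IsIsotropicConstant K L := by
  obtain ⟨u, hu, hmin⟩ := exists_isMin_normalizedSecondMoment hK hK0
  have hiso : IsIsotropic (u '' K) := fun T hT => by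
    rw [normalizedSecondMoment_image hu, normalizedSecondMoment_image hu]
    exact hmin _ (hu.trans hT)
  have huK : IsCompact (u '' K) := hK.image u.continuous_euclideanSpace
  have huK0 := interior_image_nonempty hK0 u
  have hV := volume_real_pos_of_isCompact huK huK0
  have hpos := normalizedSecondMoment_refl_pos hn huK huK0
  set c := ((volume.real (u '' K))⁻¹) ^ ((2 : ℝ) / (n : ℝ)) *
    normalizedSecondMoment (u '' K) (AffineEquiv.refl ℝ _) with hc
  have hc0 : 0 < c := by positivity
  refine ⟨√c, Real.sqrt_pos.2 hc0, u, hu, hiso, fun θ hθ => ?_⟩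
  rw [Real.sq_sqrt hc0.le, hc, hiso.normalizedSecondMoment_eq hn huK hV hθ]

/-- Two isotropic positions of `K` are volume preserving images of each other, so each second moment
bounds the other. Hence the position witnessing `L` can be exchanged for any other; uniqueness of
`L` follows too. -/
theorem IsIsotropicConstant.sq_mul_volume_rpow (hn : 1 ≤ n) (hK : IsCompact K)
    (hK0 : (interior K).Nonempty) {L : ℝ} (hL : IsIsotropicConstant K L)
    {u : EuclideanSpace ℝ (Fin n) ≃ᵃ[ℝ] EuclideanSpace ℝ (Fin n)}
    (hu : IsVolumePreservingAffine u) (hiso : IsIsotropic (u '' K)) :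
    L ^ 2 * volume.real K ^ ((2 : ℝ) / n) =
      normalizedSecondMoment (u '' K) (AffineEquiv.refl ℝ _) := by
  obtain ⟨-, w, hw, hwiso, hθ⟩ := hL
  obtain ⟨θ, hθ1⟩ := exists_norm_eq_one_of_one_le hn
  have hV := volume_real_pos_of_isCompact hK hK0
  have cmp : ∀ {u w : EuclideanSpace ℝ (Fin n) ≃ᵃ[ℝ] EuclideanSpace ℝ (Fin n)},
      IsVolumePreservingAffine u → IsVolumePreservingAffine w → IsIsotropic (u '' K) →
      normalizedSecondMoment (u '' K) (AffineEquiv.refl ℝ _) ≤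
        normalizedSecondMoment (w '' K) (AffineEquiv.refl ℝ _) := by
    intro u w hu hw hiso
    refine (hiso (u.symm.trans w) (hu.symm.trans hw)).trans_eq ?_
    rw [normalizedSecondMoment_image hu, normalizedSecondMoment_image hw]
    congr 1
    ext1 x
    simp
  rw [hθ θ hθ1, ← hwiso.normalizedSecondMoment_eq hn
    (hK.image w.continuous_euclideanSpace) (by rwa [hw.volume_real_image]) hθ1,
    hw.volume_real_image, le_antisymm (cmp hw hu hwiso) (cmp hu hw hiso), mul_right_comm,
    ← Real.mul_rpow (by positivity) (by positivity), inv_mul_cancel₀ hV.ne', Real.one_rpow,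
    one_mul]

theorem isIsotropicConstant_isotropicConstant (hn : 1 ≤ n) (hK : IsCompact K)
    (hK0 : (interior K).Nonempty) : IsIsotropicConstant K (isotropicConstant K) := by
  obtain ⟨L, hL⟩ := exists_isIsotropicConstant hn hK hK0
  have huniq : {L' | IsIsotropicConstant K L'} = {L} := by
    refine Set.eq_singleton_iff_unique_mem.2 ⟨hL, fun L' hL' => ?_⟩
    obtain ⟨hL0, u, hu, hiso, -⟩ := id hL
    have h1 := hL.sq_mul_volume_rpow hn hK hK0 hu hiso
    rw [← IsIsotropicConstant.sq_mul_volume_rpow hn hK hK0 hL' hu hiso] at h1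
    have hV := volume_real_pos_of_isCompact hK hK0
    have h2 := mul_right_cancel₀ (by positivity) h1
    exact ((sq_eq_sq₀ hL0.le hL'.1.le).1 h2).symm
  rwa [isotropicConstant, huniq, csInf_singleton]

end Isotropic

/-! ### The inequality in isotropic position -/

/-- Reverse Brunn–Minkowski-type inequality in isotropic position, in terms of second moments. -/
theorem volume_add_rpow_le_of_isIsotropic {n : ℕ} (hn : 1 ≤ n)
    {A B : Set (EuclideanSpace ℝ (Fin n))} (hA : IsCompact A) (hB : IsCompact B)
    (hAc : Convex ℝ A) (hBc : Convex ℝ B) (hA0 : (interior A).Nonempty)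
    (hB0 : (interior B).Nonempty) (hBi : IsIsotropic B) :
    volume.real (A + B) ^ ((2 : ℝ) / n) ≤ 8 * Real.pi * Real.exp 1 *
      (normalizedSecondMoment A (AffineEquiv.refl ℝ _) +
        normalizedSecondMoment B (AffineEquiv.refl ℝ _)) := by
  have hn0 : (0 : ℝ) < n := by exact_mod_cast hn
  have hVB := volume_real_pos_of_isCompact hB hB0
  refine volume_add_rpow_le hn hA hB hAc hBc (volume_real_pos_of_isCompact hA hA0) hVB
    (hBi.setIntegral_inner hn hB hVB)
    (add_pos (normalizedSecondMoment_refl_pos hn hA hA0)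
      (normalizedSecondMoment_refl_pos hn hB hB0)) ?_
  simp only [normalizedSecondMoment, AffineEquiv.refl_apply, integral_div]
  field_simp

theorem corollary9 (n : ℕ) (hn : 1 ≤ n)
    (A B : ConvexBody (EuclideanSpace ℝ (Fin n)))
    (hA : (interior (A : Set (EuclideanSpace ℝ (Fin n)))).Nonempty)
    (hB : (interior (B : Set (EuclideanSpace ℝ (Fin n)))).Nonempty) :
    IsIsotropicConstant (A : Set (EuclideanSpace ℝ (Fin n)))
        (isotropicConstant (A : Set (EuclideanSpace ℝ (Fin n)))) ∧
      IsIsotropicConstant (B : Set (EuclideanSpace ℝ (Fin n)))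
        (isotropicConstant (B : Set (EuclideanSpace ℝ (Fin n)))) ∧
      ∀ u₁ u₂ : EuclideanSpace ℝ (Fin n) ≃ᵃ[ℝ] EuclideanSpace ℝ (Fin n),
        IsVolumePreservingAffine u₁ → IsVolumePreservingAffine u₂ →
        IsIsotropic (u₁ '' (A : Set (EuclideanSpace ℝ (Fin n)))) →
        IsIsotropic (u₂ '' (B : Set (EuclideanSpace ℝ (Fin n)))) →
          1 / (8 * Real.pi * Real.exp 1) *
              volume.real (u₁ '' (A : Set (EuclideanSpace ℝ (Fin n))) +
                u₂ '' (B : Set (EuclideanSpace ℝ (Fin n)))) ^ ((2 : ℝ) / (n : ℝ)) ≤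
            isotropicConstant (A : Set (EuclideanSpace ℝ (Fin n))) ^ 2 *
                volume.real (A : Set (EuclideanSpace ℝ (Fin n))) ^ ((2 : ℝ) / (n : ℝ)) +
              isotropicConstant (B : Set (EuclideanSpace ℝ (Fin n))) ^ 2 *
                volume.real (B : Set (EuclideanSpace ℝ (Fin n))) ^ ((2 : ℝ) / (n : ℝ)) := by
  have hLA := isIsotropicConstant_isotropicConstant hn A.isCompact hA
  have hLB := isIsotropicConstant_isotropicConstant hn B.isCompact hB
  refine ⟨hLA, hLB, fun u₁ u₂ hu₁ hu₂ hi₁ hi₂ => ?_⟩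
  rw [hLA.sq_mul_volume_rpow hn A.isCompact hA hu₁ hi₁,
    hLB.sq_mul_volume_rpow hn B.isCompact hB hu₂ hi₂, div_mul_eq_mul_div, one_mul,
    div_le_iff₀' (by positivity)]
  exact volume_add_rpow_le_of_isIsotropic hn
    (A.isCompact.image u₁.continuous_euclideanSpace)
    (B.isCompact.image u₂.continuous_euclideanSpace)
    (A.convex.affine_image u₁.toAffineMap) (B.convex.affine_image u₂.toAffineMap)
    (interior_image_nonempty hA u₁) (interior_image_nonempty hB u₂) hi₂
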